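/- Let $\mathbb{F}_q$ be a finite field with $q$ elements. A linear code $\mathcal{C}\subseteq\mathbb{F}_q^n$ has locality $r$ if every coordinate $i$ has a set $I_i\subseteq[n]\setminus\{i\}$ with $|I_i|\le r$ such that, for $\alpha\ne\beta$ in $\mathbb{F}_q$, the projections onto $I_i$ of $\{c\in\mathcal{C}:c_i=\alpha\}$ and $\{c\in\mathcal{C}:c_i=\beta\}$ are disjoint. A linear code of length $n$, dimension $k$, minimum distance $d$ and locality $r$ is called an $[n,k,d;r]$-locally repairable code over $\mathbb{F}_q$; it is Singleton-optimal if $d=n-k-\lceil k/r\rceil+2$. It has disjoint recovery sets if $[n]$ can be partitioned into sets each of which is the support, of size at most $r+1$, of a codeword of the dual code $\mathcal{C}^\perp$. **Theorem.** For every real $c>0$ there is a constant $K$, depending only on $c$, such that the following holds. Let $\mathcal{C}$ be a Singleton-optimal $[n,k,d;r]$-locally repairable code with disjoint recovery sets over a finite field $\mathbb{F}_q$, where $1\le r<k$, $d\ge 5$, $d\ge r+2$, $n\ge c\,d\,r^2$, $(r+1)\mid n$ and $d\equiv 1,2,3,4$ or $5\pmod{r+1}$. Then $n\le K q^2$. In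 other words, $n=O(q^2)$ for such codes when $n=\Omega(dr^2)$. -/

import Mathlib

namespace LRC

section Codes

variable {F : Type*} [Field F] [DecidableEq F] {n : ℕ}

/-- The support `{i : u i ≠ 0}` of a vector of `F ^ n`. -/
def supp (u : Fin n → F) : Finset (Fin n) :=
  Finset.univ.filter fun i => u i ≠ 0

/-- The minimum distance of a linear code: the least Hamming distance between two distinct
codewords. -/
noncomputable def minDist (C : Submodule F (Fin n → F)) : ℕ :=
  sInf {w : ℕ | ∃ x ∈ C, ∃ y ∈ C, x ≠ y ∧ hammingDist x y = w}

/-- The (Euclidean) dual code: all vectors orthogonal to every codeword. -/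
def dualCode (C : Submodule F (Fin n → F)) : Submodule F (Fin n → F) where
  carrier := {u | ∀ x ∈ C, u ⬝ᵥ x = 0}
  add_mem' := by
    intro a b ha hb x hx
    rw [add_dotProduct, ha x hx, hb x hx, add_zero]
  zero_mem' := by
    intro x _
    exact zero_dotProduct x
  smul_mem' := by
    intro c a ha x hx
    rw [smul_dotProduct, ha x hx, smul_zero]

/-- The projection onto the coordinates in `I` of the set of codewords whose `i`-th coordinate
is `α`. -/
def localProj (C : Submodule F (Fin n → F)) (I : Finset (Fin n)) (i : Fin n) (α : F) :
    Set (I → F) :=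
  {v | ∃ x ∈ C, x i = α ∧ ∀ j : I, v j = x j}

/-- `C` has locality `r`: every coordinate `i` has a set `I` of at most `r` other coordinates such
that the projections on `I` of the codewords with distinct `i`-th coordinates are disjoint. -/
def HasLocality (C : Submodule F (Fin n → F)) (r : ℕ) : Prop :=
  ∀ i : Fin n, ∃ I : Finset (Fin n), i ∉ I ∧ I.card ≤ r ∧
    ∀ α β : F, α ≠ β → Disjoint (localProj C I i α) (localProj C I i β)

/-- `C` is an `[n, k, d; r]`-locally repairable code. -/
structure IsLRC (C : Submodule F (Fin n → F)) (k d r : ℕ) : Prop where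
  dim_eq : Module.finrank F C = k
  minDist_eq : minDist C = d
  locality : HasLocality C r

/-- `C` is a Singleton-optimal `[n, k, d; r]`-locally repairable code: it meets the Singleton-type
bound `d ≤ n - k - ⌈k / r⌉ + 2` with equality. -/
structure IsSingletonOptimal (C : Submodule F (Fin n → F)) (k d r : ℕ) : Prop
    extends IsLRC C k d r where
  optimal : (d : ℤ) = (n : ℤ) - (k : ℤ) - ⌈(k : ℚ) / (r : ℚ)⌉ + 2

/-- The supports of size at most `r + 1` of dual codewords. -/
def recoverySets (C : Submodule F (Fin n → F)) (r : ℕ) : Set (Finset (Fin n)) :=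
  {I | ∃ u ∈ dualCode C, supp u = I ∧ I.card ≤ r + 1}

/-- `C` has disjoint recovery sets: some recovery sets of `C` form a partition of the set of all
coordinates. -/
def HasDisjointRecoverySets (C : Submodule F (Fin n → F)) (r : ℕ) : Prop :=
  ∃ P : Finpartition (Finset.univ : Finset (Fin n)), ∀ I ∈ P.parts, I ∈ recoverySets C r

end Codes

end LRC

/-! Put t = ⌈k/r⌉, so that n = d + k + t - 2. The congruences give tr ≤ k + 3
(`mul_le_add_three_of_modEq`), so the union U of t recovery sets has at most k + t + 3 points and
leaves at least d - 5 outside; D consists of d - 5 of these. The t checks cut out a space L ⊇ C of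
dimension at most n - t = k + 3 + |D|.

A sphere-packing count modulo C and the vectors on D follows. Inside the recovery sets, L has |U| -
t ≥ k vectors of weight two. Their nonzero multiples stay distinct modulo both, since a codeword
supported on D and four more points has weight below d. Hence k(q - 1) ≤ q³ and k ≤ 2q²
(`card_mul_pow_le_of_weight_two`).

Finally t ≤ k, and d ≤ 2q by `minDist_le_two_mul_card`, whence n ≤ 5q². -/

namespace LRC

section Codes

/-! ### Subcodes vanishing on a set of coordinates -/

variable {F : Type*} [Field F] {n : ℕ}

/-- The subspace of the vectors of `V` that vanish on the coordinates in `S`. -/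
def vanishingOn (V : Submodule F (Fin n → F)) (S : Finset (Fin n)) :
    Submodule F (Fin n → F) where
  carrier := {x | x ∈ V ∧ ∀ i ∈ S, x i = 0}
  add_mem' := by
    rintro a b ⟨ha, ha'⟩ ⟨hb, hb'⟩
    exact ⟨V.add_mem ha hb, fun i hi => by simp [ha' i hi, hb' i hi]⟩
  zero_mem' := ⟨V.zero_mem, fun _ _ => rfl⟩
  smul_mem' := by
    rintro c a ⟨ha, ha'⟩
    exact ⟨V.smul_mem c ha, fun i hi => by simp [ha' i hi]⟩

theorem mem_vanishingOn {V : Submodule F (Fin n → F)} {S : Finset (Fin n)} {x : Fin n → F} :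
    x ∈ vanishingOn V S ↔ x ∈ V ∧ ∀ i ∈ S, x i = 0 :=
  Iff.rfl

theorem vanishingOn_univ (V : Submodule F (Fin n → F)) : vanishingOn V Finset.univ = ⊥ := by
  rw [eq_bot_iff]
  intro x hx
  rw [Submodule.mem_bot]
  ext i
  exact hx.2 i (Finset.mem_univ i)

theorem finrank_le_finrank_vanishingOn_add_card (V : Submodule F (Fin n → F))
    (S : Finset (Fin n)) :
    Module.finrank F V ≤ Module.finrank F (vanishingOn V S) + S.card := by
  let f : V →ₗ[F] (S → F) := (LinearMap.funLeft F F (Subtype.val : S → Fin n)) ∘ₗ V.subtype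
  have h1 := f.finrank_range_add_finrank_ker
  have h2 : Module.finrank F (LinearMap.range f) ≤ S.card := by
    have := Submodule.finrank_le (LinearMap.range f)
    simpa using this
  have h3 : Module.finrank F (LinearMap.ker f) ≤ Module.finrank F (vanishingOn V S) := by
    have hker : (LinearMap.ker f).map V.subtype ≤ vanishingOn V S := by
      rintro x ⟨y, hy, rfl⟩
      refine ⟨y.2, fun i hi => ?_⟩
      exact congrFun (LinearMap.mem_ker.1 hy) ⟨i, hi⟩
    calc Module.finrank F (LinearMap.ker f)
        = Module.finrank F ((LinearMap.ker f).map V.subtype) :=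
          (Submodule.finrank_map_subtype_eq V _).symm
      _ ≤ _ := Submodule.finrank_mono hker
  omega

theorem finrank_vanishingOn_le_insert (V : Submodule F (Fin n → F)) (S : Finset (Fin n))
    (i : Fin n) :
    Module.finrank F (vanishingOn V S) ≤ Module.finrank F (vanishingOn V (insert i S)) + 1 := by
  have h := finrank_le_finrank_vanishingOn_add_card (vanishingOn V S) {i}
  have heq : vanishingOn (vanishingOn V S) {i} = vanishingOn V (insert i S) := by
    ext x
    simp only [mem_vanishingOn, Finset.mem_singleton, Finset.forall_mem_insert, forall_eq]
    tauto
  rwa [heq, Finset.card_singleton] at h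

/-- Coordinates can be added to `S` until the vanishing subcode has a prescribed dimension. -/
theorem exists_superset_finrank_vanishingOn_eq (V : Submodule F (Fin n → F)) (S : Finset (Fin n))
    (j : ℕ) (hj : j ≤ Module.finrank F (vanishingOn V S)) :
    ∃ T, S ⊆ T ∧ Module.finrank F (vanishingOn V T) = j := by
  classical
  -- A largest `T` keeping dimension at least `j` works: one more coordinate lowers the dimension by
  -- at most one.
  obtain ⟨T, hT, hmax⟩ := (Finset.univ.filter fun T : Finset (Fin n) =>
      S ⊆ T ∧ j ≤ Module.finrank F (vanishingOn V T)).exists_max_image Finset.card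
    ⟨S, by simpa using hj⟩
  simp only [Finset.mem_filter, Finset.mem_univ, true_and] at hT hmax
  refine ⟨T, hT.1, le_antisymm ?_ hT.2⟩
  by_contra! hlt
  obtain ⟨i, hi⟩ : ∃ i, i ∉ T := by
    by_contra! hall
    rw [Finset.eq_univ_iff_forall.2 hall, vanishingOn_univ, finrank_bot] at hlt
    omega
  have h1 := finrank_vanishingOn_le_insert V T i
  have h2 := hmax (insert i T) ⟨hT.1.trans (Finset.subset_insert i T), by omega⟩
  rw [Finset.card_insert_of_notMem hi] at h2
  omega

/-! ### Parity checks, minimum distance and counting -/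

variable [DecidableEq F]

theorem mem_supp {u : Fin n → F} {i : Fin n} : i ∈ supp u ↔ u i ≠ 0 := by
  simp [supp]

theorem card_sdiff_image_transversal {A : Finset (Finset (Fin n))}
    (hA : (A : Set (Finset (Fin n))).PairwiseDisjoint id) {b : Finset (Fin n) → Fin n}
    (hb : ∀ G ∈ A, b G ∈ G) {S : Finset (Fin n)} (hS : ∀ G ∈ A, G ⊆ S) :
    (S \ A.image b).card + A.card = S.card := by
  have hinj : Set.InjOn b A := by
    intro G hG H hH h
    by_contra hne
    exact Finset.disjoint_left.1 (hA hG hH hne) (hb G hG) (h ▸ hb H hH)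
  have hsub : A.image b ⊆ S := by
    intro i hi
    obtain ⟨G, hG, rfl⟩ := Finset.mem_image.1 hi
    exact hS G hG (hb G hG)
  rw [← Finset.card_image_of_injOn hinj, Finset.card_sdiff_add_card_eq_card hsub]

/-- Each of the pairwise disjoint parity checks supported in `S` lowers by one the bound on the
rank of the coordinates in `S`. -/
theorem finrank_add_card_checks_le (V : Submodule F (Fin n → F)) {A : Finset (Finset (Fin n))}
    (hA : (A : Set (Finset (Fin n))).PairwiseDisjoint id) {b : Finset (Fin n) → Fin n}
    (hb : ∀ G ∈ A, b G ∈ G) {u : Finset (Fin n) → Fin n → F} (hu : ∀ G ∈ A, supp (u G) = G)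
    (hV : ∀ G ∈ A, ∀ x ∈ V, u G ⬝ᵥ x = 0) {S : Finset (Fin n)} (hS : ∀ G ∈ A, G ⊆ S) :
    Module.finrank F V + A.card ≤ Module.finrank F (vanishingOn V S) + S.card := by
  have h1 := finrank_le_finrank_vanishingOn_add_card V (S \ A.image b)
  have h2 := card_sdiff_image_transversal hA hb hS
  -- Once the rest of `G` vanishes, the check `u G` forces the coordinate `b G` to vanish too.
  have h3 : vanishingOn V (S \ A.image b) ≤ vanishingOn V S := by
    rintro x ⟨hxV, hx⟩
    refine ⟨hxV, fun i hi => ?_⟩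
    by_cases hib : i ∈ A.image b
    · obtain ⟨G, hG, rfl⟩ := Finset.mem_image.1 hib
      have hsum := hV G hG x hxV
      rw [dotProduct, Finset.sum_eq_single (b G)] at hsum
      · refine (mul_eq_zero.1 hsum).resolve_left (mem_supp.1 ?_)
        rw [hu G hG]
        exact hb G hG
      · intro j _ hj
        by_cases hjG : j ∈ G
        · rw [hx j, mul_zero]
          refine Finset.mem_sdiff.2 ⟨hS G hG hjG, fun hjb => ?_⟩
          obtain ⟨H, hH, rfl⟩ := Finset.mem_image.1 hjb
          rcases eq_or_ne H G with rfl | hne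
          · exact hj rfl
          · exact Finset.disjoint_left.1 (hA hH hG hne) (hb H hH) hjG
        · rw [← hu G hG, mem_supp, not_not] at hjG
          rw [hjG, zero_mul]
      · simp
    · exact hx i (Finset.mem_sdiff.2 ⟨hi, hib⟩)
  have h4 := Submodule.finrank_mono h3
  omega

/-- A nonzero codeword vanishing on `S` has weight at most `n - |S|`. -/
theorem minDist_add_card_le {C : Submodule F (Fin n → F)} {x : Fin n → F} (hx : x ∈ C)
    (hx0 : x ≠ 0) {S : Finset (Fin n)} (hS : ∀ i ∈ S, x i = 0) : minDist C + S.card ≤ n := by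
  have h1 : minDist C ≤ hammingDist x 0 := Nat.sInf_le ⟨x, hx, 0, C.zero_mem, hx0, rfl⟩
  have h2 : hammingDist x 0 ≤ Sᶜ.card := by
    rw [hammingDist]
    refine Finset.card_le_card fun i hi => ?_
    rw [Finset.mem_compl]
    exact fun hiS => (Finset.mem_filter.1 hi).2 (hS i hiS)
  have h3 := S.card_add_card_compl
  rw [Fintype.card_fin] at h3
  omega

theorem eq_zero_of_card_lt_minDist {C : Submodule F (Fin n → F)} {x : Fin n → F} (hx : x ∈ C)
    {T : Finset (Fin n)} (hT : T.card < minDist C) (hxT : ∀ i ∉ T, x i = 0) : x = 0 := by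
  by_contra hx0
  have h1 := minDist_add_card_le hx hx0 (S := Tᶜ) fun i hi => hxT i (Finset.mem_compl.1 hi)
  have h2 := T.card_add_card_compl
  rw [Fintype.card_fin] at h2
  omega

/-- A two-dimensional subcode supported on at most `d + 2` coordinates forces `d ≤ 2 q`. -/
theorem minDist_le_two_mul_card [Fintype F] {C : Submodule F (Fin n → F)} {S : Finset (Fin n)}
    (hS : Module.finrank F (vanishingOn C S) = 2) (hcard : n ≤ minDist C + S.card + 2) :
    minDist C ≤ 2 * Fintype.card F := by
  by_contra! hlt
  have : Nontrivial (vanishingOn C S) := Module.nontrivial_of_finrank_pos (R := F) (by omega)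
  obtain ⟨y, hy0⟩ := exists_ne (0 : vanishingOn C S)
  obtain ⟨x, hx⟩ : ∃ x : vanishingOn C S, x ∉ Submodule.span F {y} := by
    by_contra! hall
    have h1 : Submodule.span F {y} = ⊤ := Submodule.eq_top_iff'.2 hall
    have h2 := finrank_span_singleton (K := F) hy0
    rw [h1, finrank_top] at h2
    omega
  have hy0' : (y : Fin n → F) ≠ 0 := fun h => hy0 (Subtype.ext h)
  have hsupp : minDist C ≤ (supp (y : Fin n → F)).card := by
    by_contra! h
    exact hy0' (eq_zero_of_card_lt_minDist y.2.1 h fun i hi => by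
      rwa [mem_supp, not_not] at hi)
  -- More than 2q coordinates share q ratios, so some ratio `a` occurs three times; `x - a • y` then
  -- vanishes at three points outside `S`, one too many.
  obtain ⟨a, -, ha⟩ := Finset.exists_lt_card_fiber_of_mul_lt_card_of_maps_to
    (s := supp (y : Fin n → F)) (t := (Finset.univ : Finset F))
    (f := fun i => (x : Fin n → F) i / (y : Fin n → F) i) (n := 2)
    (fun _ _ => Finset.mem_univ _) (by rw [Finset.card_univ]; omega)
  set R := (supp (y : Fin n → F)).filter fun i => (x : Fin n → F) i / (y : Fin n → F) i = a
  have hz : (x - a • y : vanishingOn C S) ≠ 0 := by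
    intro h
    exact hx (Submodule.mem_span_singleton.2 ⟨a, (sub_eq_zero.1 h).symm⟩)
  have hdisj : Disjoint S R := by
    rw [Finset.disjoint_left]
    intro i hi hiR
    exact mem_supp.1 (Finset.mem_filter.1 hiR).1 (y.2.2 i hi)
  have h := minDist_add_card_le (S := S ∪ R) (x - a • y : vanishingOn C S).2.1
    (fun h => hz (Subtype.ext h)) (by
      intro i hi
      rcases Finset.mem_union.1 hi with hi | hi
      · exact (x - a • y : vanishingOn C S).2.2 i hi
      · obtain ⟨h1, h2⟩ := Finset.mem_filter.1 hi
        rw [div_eq_iff (mem_supp.1 h1)] at h2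
        simp [h2])
  rw [Finset.card_union_of_disjoint hdisj] at h
  omega

/-- A parity check with support `G` is satisfied by a vector supported on any two prescribed
coordinates of `G`. -/
theorem exists_weight_two_of_check {u : Fin n → F} {i e : Fin n} (hi : i ∈ supp u)
    (he : e ∈ supp u) (hie : i ≠ e) :
    ∃ w : Fin n → F, u ⬝ᵥ w = 0 ∧ w i ≠ 0 ∧ ∀ j, j ≠ i → j ≠ e → w j = 0 := by
  rw [mem_supp] at hi he
  refine ⟨Pi.single i (u i)⁻¹ - Pi.single e (u e)⁻¹, ?_, ?_, ?_⟩
  · simp [dotProduct_sub, dotProduct_single, hi, he]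
  · simp [hie, hi]
  · intro j h1 h2
    simp [h1, h2]

/-- Vectors `w i` of weight at most two, each having its own private coordinate `i`, together with
the code `C` and the vectors supported on `D`, fill up `|I| (q - 1) q ^ (dim C + |D|)` vectors
if `|D| + 4 < d`. -/
theorem card_mul_pow_le_of_weight_two [Fintype F] {C L : Submodule F (Fin n → F)}
    {D I : Finset (Fin n)} (hCL : C ≤ L) (hDL : ∀ x : Fin n → F, (∀ i ∉ D, x i = 0) → x ∈ L)
    (hD : D.card + 4 < minDist C) (w : Fin n → Fin n → F) (e : Fin n → Fin n)
    (hwL : ∀ i ∈ I, w i ∈ L) (hwi : ∀ i ∈ I, w i i ≠ 0)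
    (hw0 : ∀ i ∈ I, ∀ j, j ≠ i → j ≠ e i → w i j = 0) (heI : ∀ i ∈ I, e i ∉ I)
    (hID : Disjoint I D) :
    I.card * (Fintype.card F - 1) * Fintype.card F ^ (Module.finrank F C + D.card) ≤
      Fintype.card F ^ Module.finrank F L := by
  classical
  let ext : (D → F) → Fin n → F := fun f i => if h : i ∈ D then f ⟨i, h⟩ else 0
  have hext : ∀ f, ∀ i ∉ D, ext f i = 0 := fun f i hi => by simp [ext, hi]
  let φ : (I × Fˣ) × (C × (D → F)) → L := fun p =>
    ⟨(p.1.2 : F) • w p.1.1 + p.2.1 + ext p.2.2,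
      L.add_mem (L.add_mem (L.smul_mem _ (hwL _ p.1.1.2)) (hCL p.2.1.2))
        (hDL _ (hext p.2.2))⟩
  have hφ : Function.Injective φ := by
    rintro ⟨⟨⟨i, hi⟩, a⟩, ⟨x, hx⟩, f⟩ ⟨⟨⟨j, hj⟩, b⟩, ⟨y, hy⟩, g⟩ h
    have hval : ∀ l, (a : F) * w i l + x l + ext f l = (b : F) * w j l + y l + ext g l := by
      intro l
      exact congrFun (congrArg Subtype.val h) l
    -- Off `D`, the difference lives on the four points `i`, `e i`, `j`, `e j`.
    have hxy : x - y = 0 := by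
      refine eq_zero_of_card_lt_minDist (C.sub_mem hx hy)
        (T := insert i (insert (e i) (insert j (insert (e j) D)))) ?_ ?_
      · have h1 := Finset.card_insert_le i (insert (e i) (insert j (insert (e j) D)))
        have h2 := Finset.card_insert_le (e i) (insert j (insert (e j) D))
        have h3 := Finset.card_insert_le j (insert (e j) D)
        have h4 := Finset.card_insert_le (e j) D
        omega
      · intro l hl
        simp only [Finset.mem_insert, not_or] at hl
        obtain ⟨h1, h2, h3, h4, h5⟩ := hl
        have hl := hval l
        rw [hw0 i hi l h1 h2, hw0 j hj l h3 h4, hext f l h5, hext g l h5] at hl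
        simpa [sub_eq_zero] using hl
    obtain rfl : x = y := sub_eq_zero.1 hxy
    have hi' := hval i
    have hiD : i ∉ D := Finset.disjoint_left.1 hID hi
    rw [hext f i hiD, hext g i hiD, add_zero, add_zero, add_left_inj] at hi'
    have hij : i = j := by
      by_contra hij
      rw [hw0 j hj i hij (fun h => heI j hj (h ▸ hi)), mul_zero] at hi'
      exact mul_ne_zero a.ne_zero (hwi i hi) hi'
    subst hij
    obtain rfl : a = b := Units.ext (mul_right_cancel₀ (hwi i hi) hi')
    obtain rfl : f = g := by
      funext l
      have hl := hval l
      rw [add_right_inj] at hl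
      simpa [ext] using hl
    rfl
  have hle := Fintype.card_le_of_injective φ hφ
  have hC : Fintype.card C = Fintype.card F ^ Module.finrank F C := Module.card_eq_pow_finrank
  have hL : Fintype.card L = Fintype.card F ^ Module.finrank F L := Module.card_eq_pow_finrank
  rw [Fintype.card_prod, Fintype.card_prod, Fintype.card_prod, hC, hL, Fintype.card_units,
    Fintype.card_fun, Fintype.card_coe, Fintype.card_coe, ← pow_add] at hle
  exact hle

/-! ### The quadratic length bound -/

/-- If `d = n - k - t + 2`, the disjoint recovery sets have size at most `r + 1`, and
`t r ≤ k + 3` for some `t` with `(t - 1) r < k`, then `n ≤ 5 q ^ 2`. -/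
theorem length_le_five_mul_card_sq [Fintype F] {C : Submodule F (Fin n → F)} {r t : ℕ}
    (hr : 1 ≤ r) (hd5 : 5 ≤ minDist C)
    (hopt : minDist C + Module.finrank F C + t = n + 2) (htr : t * r ≤ Module.finrank F C + 3)
    (htk : t * r < Module.finrank F C + r) (hrk : r < Module.finrank F C)
    (hkt : Module.finrank F C ≤ t * r) (hdis : HasDisjointRecoverySets C r) :
    n ≤ 5 * Fintype.card F ^ 2 := by
  obtain ⟨P, hP⟩ := hdis
  set k := Module.finrank F C with hk
  have hP' : ∀ G, ∃ u : Fin n → F, G ∈ P.parts →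
      u ∈ dualCode C ∧ supp u = G ∧ G.card ≤ r + 1 := by
    intro G
    by_cases hG : G ∈ P.parts
    · obtain ⟨u, hu⟩ := hP G hG
      exact ⟨u, fun _ => hu⟩
    · exact ⟨0, fun h => absurd h hG⟩
  choose u hu using hP'
  have hn : 0 < n := by omega
  have hb' : ∀ G : Finset (Fin n), ∃ i, G ∈ P.parts → i ∈ G := by
    intro G
    by_cases hG : G ∈ P.parts
    · obtain ⟨i, hi⟩ := P.nonempty_of_mem_parts hG
      exact ⟨i, fun _ => hi⟩
    · exact ⟨⟨0, hn⟩, fun h => absurd h hG⟩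
  choose b hb using hb'
  have hrank : ∀ A ⊆ P.parts, ∀ S, (∀ G ∈ A, G ⊆ S) →
      k + A.card ≤ Module.finrank F (vanishingOn C S) + S.card := fun A hA S hS =>
    finrank_add_card_checks_le C (P.disjoint.subset hA) (fun G hG => hb G (hA hG))
      (fun G hG => (hu G (hA hG)).2.1) (fun G hG => (hu G (hA hG)).1) hS
  have hunion : ∀ A ⊆ P.parts, (A.biUnion id).card ≤ A.card * (r + 1) := fun A hA =>
    Finset.card_biUnion_le_card_mul A id (r + 1) fun G hG => (hu G (hA hG)).2.2
  have hsub : ∀ A : Finset (Finset (Fin n)), ∀ G ∈ A, G ⊆ A.biUnion id := fun A G hG =>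
    Finset.subset_biUnion_of_mem id hG
  have ht2 : 2 ≤ t := by
    by_contra! h
    have : t * r ≤ 1 * r := Nat.mul_le_mul_right r (by omega)
    omega
  have hparts : t ≤ P.parts.card := by
    have h1 := hrank P.parts subset_rfl Finset.univ fun _ _ => Finset.subset_univ _
    have h2 := hunion P.parts subset_rfl
    have h3 : P.parts.biUnion id = Finset.univ := P.biUnion_parts
    rw [vanishingOn_univ, finrank_bot] at h1
    rw [h3, mul_add] at h2
    by_contra! h
    have : (P.parts.card + 1) * r ≤ t * r := Nat.mul_le_mul_right r h
    rw [add_mul] at this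
    omega
  -- On t - 2 recovery sets the rank is at most (t - 2)r < k - r, so a subcode of dimension at least
  -- 2 vanishes there.
  have hd : minDist C ≤ 2 * Fintype.card F := by
    obtain ⟨A, hA, hAcard⟩ := Finset.exists_subset_card_eq (show t - 2 ≤ P.parts.card by omega)
    have h1 := hrank A hA (A.biUnion id) (hsub A)
    have h2 := hunion A hA
    have h3 : (t - 2) * r + 2 * r = t * r := by rw [← add_mul]; congr 1; omega
    rw [hAcard] at h1 h2
    rw [mul_add] at h2
    obtain ⟨S, hAS, hS⟩ := exists_superset_finrank_vanishingOn_eq C (A.biUnion id) 2 (by omega)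
    have h4 := hrank A hA S fun G hG => (hsub A G hG).trans hAS
    exact minDist_le_two_mul_card hS (by omega)
  obtain ⟨B, hB, hBcard⟩ := Finset.exists_subset_card_eq hparts
  have hBdisj := P.disjoint.subset (s := (B : Set (Finset (Fin n)))) hB
  -- Otherwise some nonzero codeword vanishes on at least k + t - 1 = n - d + 1 coordinates.
  have hfull : Module.finrank F (vanishingOn C (B.biUnion id)) = 0 := by
    by_contra h
    obtain ⟨S, hBS, hS⟩ := exists_superset_finrank_vanishingOn_eq C (B.biUnion id) 1 (by omega)
    have h1 := hrank B hB S fun G hG => (hsub B G hG).trans hBS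
    have : Nontrivial (vanishingOn C S) := Module.nontrivial_of_finrank_pos (R := F) (by omega)
    obtain ⟨x, hx⟩ := exists_ne (0 : vanishingOn C S)
    have h2 := minDist_add_card_le x.2.1 (fun h => hx (Subtype.ext h)) x.2.2
    omega
  have hkB := hrank B hB (B.biUnion id) (hsub B)
  obtain ⟨D, hDsub, hDcard⟩ := Finset.exists_subset_card_eq
    (show minDist C - 5 ≤ (B.biUnion id)ᶜ.card by
      have h1 := hunion B hB
      have h2 := (B.biUnion id).card_add_card_compl
      rw [Fintype.card_fin] at h2
      rw [hBcard, mul_add] at h1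
      omega)
  let L : Submodule F (Fin n → F) :=
    { carrier := {x | ∀ G ∈ B, u G ⬝ᵥ x = 0}
      add_mem' := fun {x y} hx hy G hG => by rw [dotProduct_add, hx G hG, hy G hG, add_zero]
      zero_mem' := fun G _ => dotProduct_zero _
      smul_mem' := fun c x hx G hG => by rw [dotProduct_smul, hx G hG, smul_zero] }
  have hLrank : Module.finrank F L + t ≤ n := by
    have h := finrank_add_card_checks_le L hBdisj (fun G hG => hb G (hB hG))
      (fun G hG => (hu G (hB hG)).2.1) (fun G hG x hx => hx G hG)
      (S := Finset.univ) fun _ _ => Finset.subset_univ _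
    rw [vanishingOn_univ, finrank_bot, hBcard, Finset.card_univ, Fintype.card_fin] at h
    omega
  have hzero : ∀ G ∈ B, ∀ i ∉ G, u G i = 0 := by
    intro G hG i hi
    rwa [← (hu G (hB hG)).2.1, mem_supp, not_not] at hi
  have hw' : ∀ i, ∃ (w : Fin n → F) (e : Fin n), i ∈ B.biUnion id \ B.image b →
      w ∈ L ∧ w i ≠ 0 ∧ (∀ j, j ≠ i → j ≠ e → w j = 0) ∧ e ∈ B.image b := by
    intro i
    by_cases hi : i ∈ B.biUnion id \ B.image b
    · obtain ⟨hi1, hi2⟩ := Finset.mem_sdiff.1 hi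
      obtain ⟨G, hG, hiG⟩ := Finset.mem_biUnion.1 hi1
      rw [id] at hiG
      have hbG := Finset.mem_image_of_mem b hG
      have hs := (hu G (hB hG)).2.1
      obtain ⟨w, h1, h2, h3⟩ := exists_weight_two_of_check (u := u G) (i := i) (e := b G)
        (by rwa [hs]) (by rw [hs]; exact hb G (hB hG)) (fun h => hi2 (h ▸ hbG))
      refine ⟨w, b G, fun _ => ⟨fun H hH => ?_, h2, h3, hbG⟩⟩
      rcases eq_or_ne H G with rfl | hne
      · exact h1
      · have hdis := Finset.disjoint_left.1 (hBdisj hG hH hne.symm)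
        refine Finset.sum_eq_zero fun j _ => ?_
        by_cases hj : j ∈ G
        · rw [hzero H hH j (hdis hj), zero_mul]
        · rw [h3 j (fun h => hj (h ▸ hiG)) (fun h => hj (h ▸ hb G (hB hG))), mul_zero]
    · exact ⟨0, i, fun h => absurd h hi⟩
  choose w e hwe using hw'
  have hcount := card_mul_pow_le_of_weight_two (C := C) (L := L) (D := D)
    (I := B.biUnion id \ B.image b) (fun x hx G hG => (hu G (hB hG)).1 x hx)
    (by
      intro x hx G hG
      refine Finset.sum_eq_zero fun j _ => ?_
      by_cases hj : j ∈ D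
      · rw [hzero G hG j fun hjG =>
          Finset.mem_compl.1 (hDsub hj) (hsub B G hG hjG), zero_mul]
      · rw [hx j hj, mul_zero])
    (by omega) w e (fun i hi => (hwe i hi).1) (fun i hi => (hwe i hi).2.1)
    (fun i hi => (hwe i hi).2.2.1)
    (fun i hi h => (Finset.mem_sdiff.1 h).2 (hwe i hi).2.2.2)
    (by
      rw [Finset.disjoint_left]
      exact fun i hi hiD => Finset.mem_compl.1 (hDsub hiD) (Finset.mem_sdiff.1 hi).1)
  have hI := card_sdiff_image_transversal hBdisj (fun G hG => hb G (hB hG)) (hsub B)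
  set N := (B.biUnion id \ B.image b).card
  set q := Fintype.card F with hq
  have hq2 : 2 ≤ q := Fintype.one_lt_card
  have hkN : k ≤ N := by omega
  -- The exponent 3 is (n - t) - (k + d - 5).
  have hNq : N * (q - 1) ≤ q ^ 3 := by
    refine Nat.le_of_mul_le_mul_right (hcount.trans ?_) (pow_pos (by omega : 0 < q) (k + D.card))
    rw [← pow_add]
    exact Nat.pow_le_pow_right (by omega) (by omega)
  have hk2 : k ≤ 2 * q ^ 2 := by
    have h1 : k * q ≤ (2 * q ^ 2) * q := by
      calc k * q ≤ N * (2 * (q - 1)) := Nat.mul_le_mul hkN (by omega)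
        _ = 2 * (N * (q - 1)) := by ring
        _ ≤ 2 * q ^ 3 := Nat.mul_le_mul_left 2 hNq
        _ = (2 * q ^ 2) * q := by ring
    exact Nat.le_of_mul_le_mul_right h1 (by omega)
  have htk' : t ≤ k := by
    have h1 : (t - 1) * r + r = t * r := by
      rw [← Nat.succ_mul]; congr 1; omega
    have h2 : (t - 1) * 1 ≤ (t - 1) * r := Nat.mul_le_mul_left _ hr
    omega
  have hqq : 2 * q ≤ q ^ 2 := by rw [sq]; exact Nat.mul_le_mul_right q hq2
  omega

end Codes

/-! ### Arithmetic of the congruence and conclusion -/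

/-- If `t = ⌈k / r⌉`, `(r + 1) ∣ d + k + t - 2` and `d` is congruent to one of `1, …, 5` modulo
`r + 1`, then `t r` exceeds `k` by at most three. -/
theorem mul_le_add_three_of_modEq {n k d r t a : ℕ} (hopt : d + k + t = n + 2)
    (htk : t * r < k + r) (hn : (r + 1) ∣ n) (ha : a ∈ Finset.Icc 1 5)
    (hd : d ≡ a [MOD r + 1]) : t * r ≤ k + 3 := by
  rw [Finset.mem_Icc] at ha
  by_contra! hlt
  obtain ⟨m, rfl⟩ := hn
  obtain ⟨v, hv⟩ := (Nat.modEq_iff_dvd.1 hd)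
  -- This multiple of r + 1 would lie strictly between 0 and r + 1 if tr ≥ k + 4, because 1 ≤ a ≤ 5.
  have h1 : ((t : ℤ) * r - k + 2 - a) = ((r : ℤ) + 1) * (t - m - v) := by
    push_cast at hv
    have : (d : ℤ) + k + t = (r + 1) * m + 2 := by exact_mod_cast hopt
    linear_combination -this - hv
  have h2 : (0 : ℤ) < (t : ℤ) * r - k + 2 - a := by
    have : ((k : ℤ) + 3) < t * r := by exact_mod_cast hlt
    omega
  have h3 : (t : ℤ) * r - k + 2 - a < r + 1 := by
    have : ((t : ℤ) * r) < k + r := by exact_mod_cast htk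
    omega
  have h4 := Int.le_of_dvd h2 ⟨_, h1⟩
  omega

end LRC

theorem mainTheorem9 :
    ∀ c : ℝ, 0 < c → ∃ K : ℝ,
      ∀ (F : Type*) [Field F] [Fintype F] [DecidableEq F] (n k d r : ℕ)
        (C : Submodule F (Fin n → F)),
        1 ≤ r → r < k → 5 ≤ d → r + 2 ≤ d →
        c * (d : ℝ) * (r : ℝ) ^ 2 ≤ (n : ℝ) →
        (r + 1) ∣ n →
        (∃ a ∈ Finset.Icc 1 5, d ≡ a [MOD r + 1]) →
        LRC.IsSingletonOptimal C k d r →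
        LRC.HasDisjointRecoverySets C r →
        (n : ℝ) ≤ K * (Fintype.card F : ℝ) ^ 2 := by
  intro c _
  refine ⟨5, ?_⟩
  intro F _ _ _ n k d r C hr hrk hd5 _ _ hn ⟨a, ha, hda⟩ hC hdis
  have hr0 : (0 : ℚ) < r := by exact_mod_cast hr
  obtain ⟨t, ht⟩ : ∃ t : ℕ, ⌈(k : ℚ) / (r : ℚ)⌉ = t :=
    Int.eq_ofNat_of_zero_le (Int.ceil_nonneg (by positivity))
  have hopt : d + k + t = n + 2 := by
    have := hC.optimal
    rw [ht] at this
    omega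
  have hkt : k ≤ t * r := by
    have h := Int.le_ceil ((k : ℚ) / (r : ℚ))
    rw [ht, div_le_iff₀ hr0] at h
    exact_mod_cast h
  have htk : t * r < k + r := by
    have h := Int.ceil_lt_add_one ((k : ℚ) / (r : ℚ))
    rw [ht, div_add_one hr0.ne', lt_div_iff₀ hr0] at h
    exact_mod_cast h
  have htr := LRC.mul_le_add_three_of_modEq hopt htk hn ha hda
  obtain rfl := hC.dim_eq
  obtain rfl := hC.minDist_eq
  exact_mod_cast LRC.length_le_five_mul_card_sq hr hd5 hopt htr htk hrk hkt hdis
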